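/- Let $F$ be a continuous cumulative distribution function on $\mathbb{R}$. For a sample $x_1,\dots,x_n$ ($n\ge 1$) with order statistics $x_{(1)}\le\dots\le x_{(n)}$ put $u_{(i)}=F(x_{(i)})$ and $$p_{(i)}=\Pr[\mathrm{Beta}(i,n-i+1)<u_{(i)}],\qquad 1\le i\le n,$$ and define $$M_n^+=\min_{1\le i\le n}p_{(i)},\qquad M_n^-=\min_{1\le i\le n}(1-p_{(i)}),\qquad M_n=\min\{M_n^+,M_n^-\}.$$ Let $\mathcal H_0$ denote the null hypothesis that the observations are i.i.d. with distribution function $F$. For any $c\in[0,1]$ let $q_c=q_{c,n}=\Pr[M_n^+\le c\mid\mathcal H_0]$. Then for every $n\ge 1$ $$2q_c-q_c^2\ \le\ \Pr[M_n\le c\mid\mathcal H_0]\ \le\ 2q_c.$$ Furthermore, for every fixed $c\in[0,1]$, $$\Pr[M_n\le c\mid\mathcal H_0]-\bigl(2q_{c,n}-q_{c,n}^2\bigr)\longrightarrow 0\qquad\text{as } n\to\infty .$$ -/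

import Mathlib

open MeasureTheory ProbabilityTheory Filter Topology

noncomputable section

namespace BerkJones

/-- The order statistics of a sample `x`: `orderStat x k` is the `(k+1)`-th smallest observation
(indices in `Fin n` start at `0`), so `orderStat x` is the nondecreasing rearrangement of `x`. -/
def orderStat {n : ℕ} (x : Fin n → ℝ) (k : Fin n) : ℝ :=
  x (Tuple.sort x k)

/-- The one-sided p-value `p_(i) = Pr[Beta(i, n - i + 1) < F(x_(i))]` of the `i`-th order
statistic, where `i = k + 1`, so that `n - i + 1 = n - k`. -/
def pValue {n : ℕ} (F : ℝ → ℝ) (x : Fin n → ℝ) (k : Fin n) : ℝ :=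
  (betaMeasure ((k : ℝ) + 1) ((n : ℝ) - (k : ℝ))).real (Set.Iio (F (orderStat x k)))

/-- `M_n^+ = min_i p_(i)`; the infimum is over a finite index set, nonempty when `1 ≤ n`. -/
def Mplus {n : ℕ} (F : ℝ → ℝ) (x : Fin n → ℝ) : ℝ :=
  ⨅ k : Fin n, pValue F x k

/-- `M_n^- = min_i (1 - p_(i))`. -/
def Mminus {n : ℕ} (F : ℝ → ℝ) (x : Fin n → ℝ) : ℝ :=
  ⨅ k : Fin n, (1 - pValue F x k)

/-- The two-sided exact Berk-Jones statistic `M_n = min {M_n^+, M_n^-}`. -/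
def M {n : ℕ} (F : ℝ → ℝ) (x : Fin n → ℝ) : ℝ :=
  min (Mplus F x) (Mminus F x)

/-- The null hypothesis for a sample `X` of size `n`: the observations are independent and each
has law `ν`. -/
structure NullSample {Ω : Type*} [MeasurableSpace Ω] {n : ℕ} (ν : Measure ℝ)
    (P : Measure Ω) (X : Fin n → Ω → ℝ) : Prop where
  hasLaw : ∀ i, HasLaw (X i) ν P
  indep : iIndepFun X P

end BerkJones

end

noncomputable section

namespace BerkJones

/-! ### Order statistics -/

/-! Applying the continuous `F` turns the null sample into independent uniforms (`map_cdf_eq_unif`).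
There `{M⁺ ≤ c}` is a lower set and `{M⁻ ≤ c}` an upper set, and `x ↦ 1 - x` exchanges them, so both
have probability `q`. Inclusion-exclusion gives `Pr[M ≤ c] = 2q - Pr[both]`, and Harris' inequality
gives `0 ≤ Pr[both] ≤ q²`.

For the limit, `Pr[M ≤ c]` lies between `2q - q²` and `1`, a gap of `(1 - q)²`. If `c = 0` then `q =
0`; if `c > 0` it suffices that `q → 1`. Take disjoint intervals `(s/(n+1), s²/(n+1)]` at rapidly
growing scales `s`. Each count has mean about `s² - s` and standard deviation at most about `s`, so
it reaches `s² + T s` with probability at least some `δ > 0` independent of the scale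
(`binomLT_le_of_large`). Chebyshev's inequality for the beta law then makes one p-value at most `2/T
≤ c` (`Mplus_id_le_of_le_count`). The counts are negatively dependent
(`measureReal_forall_count_lt_le`), so `K` scales all fail with probability at most `(1 - δ)^K`. -/

theorem monotone_orderStat_index {n : ℕ} (x : Fin n → ℝ) : Monotone (orderStat x) :=
  Tuple.monotone_sort x

/-- The `(k+1)`-th order statistic is at most `t` iff more than `k` observations are. -/
theorem orderStat_le_iff {n : ℕ} (x : Fin n → ℝ) (k : Fin n) (t : ℝ) :
    orderStat x k ≤ t ↔ (k : ℕ) < Fintype.card {i // x i ≤ t} := by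
  have h := Tuple.lt_card_le_iff_apply_le_of_monotone (j := k) (f := orderStat x) (a := t)
    (monotone_orderStat_index x)
  rw [← h, ← Fintype.card_subtype, Fintype.card_congr
    ((Tuple.sort x).subtypeEquiv (p := fun i => orderStat x i ≤ t) (q := fun i => x i ≤ t)
      (fun _ => Iff.rfl))]

theorem monotone_orderStat {n : ℕ} (k : Fin n) : Monotone fun x : Fin n → ℝ => orderStat x k := by
  intro x y hxy
  have h := (orderStat_le_iff y k _).1 le_rfl
  exact (orderStat_le_iff x k _).2
    (h.trans_le (Fintype.card_subtype_mono _ _ fun i hi => (hxy i).trans hi))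

/-- With ties the sorting permutation is not unique, but the sorted values are. Monotone maps and
reflections of the sample can therefore use whichever permutation is convenient. -/
theorem orderStat_eq_of_monotone {n : ℕ} (x : Fin n → ℝ) (σ : Equiv.Perm (Fin n))
    (h : Monotone (x ∘ σ)) (k : Fin n) : orderStat x k = x (σ k) :=
  (congrFun (Tuple.comp_sort_eq_comp_iff_monotone.2 h) k).symm

theorem orderStat_comp_monotone {n : ℕ} {f : ℝ → ℝ} (hf : Monotone f) (x : Fin n → ℝ)
    (k : Fin n) : orderStat (fun i => f (x i)) k = f (orderStat x k) :=
  orderStat_eq_of_monotone (fun i => f (x i)) (Tuple.sort x)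
    (hf.comp (Tuple.monotone_sort x)) k

theorem orderStat_one_sub {n : ℕ} (x : Fin n → ℝ) (k : Fin n) :
    orderStat (fun i => 1 - x i) k = 1 - orderStat x k.rev :=
  orderStat_eq_of_monotone (fun i => 1 - x i) (Fin.revPerm.trans (Tuple.sort x))
    (fun _ _ hij => sub_le_sub_left
      (Tuple.monotone_sort x (Fin.rev_le_rev.2 hij)) 1) k

theorem measurable_orderStat {n : ℕ} (k : Fin n) :
    Measurable fun x : Fin n → ℝ => orderStat x k := by
  refine measurable_of_Iic fun t => ?_
  have : (fun x : Fin n → ℝ => orderStat x k) ⁻¹' Set.Iic t =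
      ⋃ s ∈ (Finset.univ.filter fun s : Finset (Fin n) => (k : ℕ) < s.card),
        ⋂ i ∈ s, {x : Fin n → ℝ | x i ≤ t} := by
    ext x
    simp only [Set.mem_preimage, Set.mem_Iic, orderStat_le_iff, Finset.mem_filter,
      Finset.mem_univ, true_and, Set.mem_iUnion, Set.mem_iInter, Set.mem_ofPred_eq, exists_prop,
      Fintype.card_subtype]
    refine ⟨fun h => ⟨_, h, fun i hi => (Finset.mem_filter.1 hi).2⟩, ?_⟩
    rintro ⟨s, hs, h⟩
    exact hs.trans_le (Finset.card_le_card fun i hi => Finset.mem_filter.2 ⟨Finset.mem_univ _, h i hi⟩)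
  rw [this]
  refine Finset.measurableSet_biUnion _ fun s _ => Finset.measurableSet_biInter _ fun i _ => ?_
  exact measurableSet_le (measurable_pi_apply i) measurable_const

/-! ### The beta distribution -/

instance nullSingletonClass_betaMeasure (α β : ℝ) : NullSingletonClass (betaMeasure α β) := by
  unfold betaMeasure; infer_instance

theorem beta_comm (α β : ℝ) : beta α β = beta β α := by
  simp only [beta, add_comm α β, mul_comm (Real.Gamma α)]

theorem betaPDF_one_sub (α β x : ℝ) : betaPDF α β (1 - x) = betaPDF β α x := by
  have h : (0 < 1 - x ∧ 1 - x < 1) ↔ (0 < x ∧ x < 1) := by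
    constructor <;> rintro ⟨_, _⟩ <;> constructor <;> linarith
  simp only [betaPDF_eq, h, beta_comm α β, sub_sub_cancel]
  congr 2; ring

theorem betaMeasure_Iio_one_sub (α β t : ℝ) :
    betaMeasure α β (Set.Iio (1 - t)) = betaMeasure β α (Set.Ioi t) := by
  rw [betaMeasure, betaMeasure, withDensity_apply _ measurableSet_Iio,
    withDensity_apply _ measurableSet_Ioi]
  have h := (Measure.measurePreserving_sub_left (volume : Measure ℝ) 1).setLIntegral_comp_preimage_emb
    (measurableEmbedding_subLeft 1) (betaPDF α β) (Set.Iio (1 - t))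
  rw [← h]
  simp only [betaPDF_one_sub]
  congr 2
  ext x; simp

theorem betaMeasure_real_Iio_one_sub {α β : ℝ} (hα : 0 < α) (hβ : 0 < β) (t : ℝ) :
    (betaMeasure α β).real (Set.Iio (1 - t)) = 1 - (betaMeasure β α).real (Set.Iio t) := by
  have := isProbabilityMeasureBeta hβ hα
  rw [measureReal_def, betaMeasure_Iio_one_sub, ← measureReal_def, ← Set.compl_Iic,
    probReal_compl_eq_one_sub measurableSet_Iic, measureReal_congr Iio_ae_eq_Iic]

/-- The density is positive on `(0, min t 1)`, a set of positive length. This is used for the case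
`c = 0`. -/
theorem betaMeasure_real_Iio_pos {α β : ℝ} (hα : 0 < α) (hβ : 0 < β) {t : ℝ} (ht : 0 < t) :
    0 < (betaMeasure α β).real (Set.Iio t) := by
  have := isProbabilityMeasureBeta hα hβ
  rw [measureReal_def]
  refine ENNReal.toReal_pos (fun h0 => ?_) (measure_ne_top _ _)
  rw [betaMeasure, withDensity_apply _ measurableSet_Iio,
    lintegral_eq_zero_iff (by unfold betaPDF; fun_prop)] at h0
  have h1 := (ae_restrict_iff' measurableSet_Iio).1 h0
  have h2 : (volume : Measure ℝ) (Set.Ioo 0 (min t 1)) = 0 := by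
    refine measure_mono_null (fun x hx => ?_) h1
    simp only [Set.mem_Ioo, lt_min_iff] at hx
    have := betaPDFReal_pos hx.1 hx.2.2 hα hβ
    simp only [Set.mem_compl_iff, Set.mem_ofPred_eq, Set.mem_Iio, Pi.zero_apply, betaPDF]
    intro h
    exact (ENNReal.ofReal_pos.2 this).ne' (h hx.2.1)
  simp at h2
  exact absurd h2 ht.not_ge

theorem monotone_betaMeasure_real_Iio {α β : ℝ} (hα : 0 < α) (hβ : 0 < β) :
    Monotone fun t => (betaMeasure α β).real (Set.Iio t) := by
  have := isProbabilityMeasureBeta hα hβ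
  exact fun s t h => measureReal_mono (Set.Iio_subset_Iio h)

theorem betaPDFReal_nonneg {α β : ℝ} (hα : 0 < α) (hβ : 0 < β) (x : ℝ) :
    0 ≤ betaPDFReal α β x := by
  by_cases h : 0 < x ∧ x < 1
  · exact (betaPDFReal_pos h.1 h.2 hα hβ).le
  · simp [betaPDFReal, h]

theorem integrable_betaPDFReal {α β : ℝ} (hα : 0 < α) (hβ : 0 < β) :
    Integrable (betaPDFReal α β) := by
  refine ⟨by fun_prop, ?_⟩
  rw [hasFiniteIntegral_iff_ofReal (ae_of_all _ (betaPDFReal_nonneg hα hβ))]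
  exact (lintegral_betaPDF_eq_one hα hβ).trans_lt ENNReal.one_lt_top

theorem integral_betaPDFReal {α β : ℝ} (hα : 0 < α) (hβ : 0 < β) :
    ∫ x, betaPDFReal α β x = 1 := by
  rw [integral_eq_lintegral_of_nonneg_ae (ae_of_all _ (betaPDFReal_nonneg hα hβ)) (by fun_prop)]
  have := lintegral_betaPDF_eq_one hα hβ
  simp only [betaPDF] at this
  rw [this, ENNReal.toReal_one]

theorem betaMeasure_real_eq_integral {α β : ℝ} (hα : 0 < α) (hβ : 0 < β) {s : Set ℝ}
    (hs : MeasurableSet s) :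
    (betaMeasure α β).real s = ∫ x in s, betaPDFReal α β x := by
  rw [measureReal_def, betaMeasure, withDensity_apply _ hs,
    integral_eq_lintegral_of_nonneg_ae (ae_of_all _ (betaPDFReal_nonneg hα hβ)) (by fun_prop)]
  rfl

/-- Since size-biasing only shifts `α`, applying this once or twice reduces the first two moments to
total masses of beta densities. -/
theorem mul_betaPDFReal {α β : ℝ} (hα : 0 < α) (hβ : 0 < β) (x : ℝ) :
    x * betaPDFReal α β x = α / (α + β) * betaPDFReal (α + 1) β x := by
  by_cases h : 0 < x ∧ x < 1
  · have hb : beta (α + 1) β = α / (α + β) * beta α β := by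
      have h1 := (Real.Gamma_pos_of_pos (add_pos hα hβ)).ne'
      have h2 := (add_pos hα hβ).ne'
      simp only [beta, add_right_comm α 1 β, Real.Gamma_add_one hα.ne', Real.Gamma_add_one h2]
      field_simp
    have h3 := (beta_pos hα hβ).ne'
    have h2 := (add_pos hα hβ).ne'
    simp only [betaPDFReal, h, and_self, if_true, hb, add_sub_right_comm α 1 1,
      Real.rpow_add_one h.1.ne']
    field_simp
  · simp [betaPDFReal, h]

/-- Chebyshev's inequality for the lower tail of a beta distribution. -/
theorem betaMeasure_real_Iio_mul_le {α β : ℝ} (hα : 0 < α) (hβ : 0 < β) {t : ℝ}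
    (ht : t ≤ α / (α + β)) :
    (α / (α + β) - t) ^ 2 * (betaMeasure α β).real (Set.Iio t) ≤
      α / (α + β) * ((α + 1) / (α + 1 + β) - α / (α + β)) := by
  set m := α / (α + β) with hm
  have h1 : 0 < α + 1 := by linarith
  have h2 : 0 < α + 1 + 1 := by linarith
  have i0 := integrable_betaPDFReal hα hβ
  have i1 := integrable_betaPDFReal h1 hβ
  have i2 := integrable_betaPDFReal h2 hβ
  have key : ∀ x, (m - x) ^ 2 * betaPDFReal α β x =
      m ^ 2 * betaPDFReal α β x - 2 * m * m * betaPDFReal (α + 1) β x +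
        m * ((α + 1) / (α + 1 + β)) * betaPDFReal (α + 1 + 1) β x := by
    intro x
    have e1 := mul_betaPDFReal hα hβ x
    have e2 := mul_betaPDFReal h1 hβ x
    rw [← hm] at e1
    linear_combination (x - 2 * m) * e1 + m * e2
  have hint : Integrable fun x => (m - x) ^ 2 * betaPDFReal α β x := by
    simp only [key]
    exact ((i0.const_mul _).sub (i1.const_mul _)).add (i2.const_mul _)
  have hval : ∫ x, (m - x) ^ 2 * betaPDFReal α β x = m * ((α + 1) / (α + 1 + β) - m) := by
    simp only [key]
    rw [integral_add (by exact (i0.const_mul _).sub (i1.const_mul _)) (i2.const_mul _),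
      integral_sub (i0.const_mul _) (i1.const_mul _)]
    simp only [integral_const_mul, integral_betaPDFReal hα hβ, integral_betaPDFReal h1 hβ,
      integral_betaPDFReal h2 hβ]
    ring
  rw [betaMeasure_real_eq_integral hα hβ measurableSet_Iio, ← integral_const_mul, ← hval]
  refine (setIntegral_mono_on (i0.const_mul _).integrableOn hint.integrableOn measurableSet_Iio
    fun x hx => ?_).trans (setIntegral_le_integral hint (ae_of_all _ fun x =>
      mul_nonneg (sq_nonneg _) (betaPDFReal_nonneg hα hβ x)))
  have hx' : x < t := hx
  exact mul_le_mul_of_nonneg_right (pow_le_pow_left₀ (by linarith) (by linarith) 2)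
    (betaPDFReal_nonneg hα hβ x)

/-! ### The statistics -/

theorem shape_pos {n : ℕ} (k : Fin n) : 0 < (k : ℝ) + 1 ∧ 0 < (n : ℝ) - k :=
  ⟨by positivity, sub_pos.2 (Nat.cast_lt.2 k.2)⟩

theorem monotone_pValue_id {n : ℕ} (k : Fin n) :
    Monotone fun x : Fin n → ℝ => pValue id x k :=
  (monotone_betaMeasure_real_Iio (shape_pos k).1 (shape_pos k).2).comp (monotone_orderStat k)

theorem measurable_pValue_id {n : ℕ} (k : Fin n) :
    Measurable fun x : Fin n → ℝ => pValue id x k :=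
  (monotone_betaMeasure_real_Iio (shape_pos k).1 (shape_pos k).2).measurable.comp
    (measurable_orderStat k)

theorem pValue_comp_monotone {n : ℕ} {F : ℝ → ℝ} (hF : Monotone F) (x : Fin n → ℝ) (k : Fin n) :
    pValue F x k = pValue id (fun i => F (x i)) k := by
  simp only [pValue, orderStat_comp_monotone hF, id]

theorem pValue_id_one_sub {n : ℕ} (x : Fin n → ℝ) (k : Fin n) :
    pValue id (fun i => 1 - x i) k = 1 - pValue id x k.rev := by
  simp only [pValue, id, orderStat_one_sub]
  rw [betaMeasure_real_Iio_one_sub (shape_pos k).1 (shape_pos k).2]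
  have hk : ((k.rev : ℕ) : ℝ) = n - (k + 1) := by
    rw [Fin.val_rev, Nat.cast_sub k.2]; push_cast; ring
  rw [hk, show (n : ℝ) - (k + 1) + 1 = n - k by ring, show (n : ℝ) - (n - (k + 1)) = k + 1 by ring]

theorem Mplus_id_one_sub {n : ℕ} (x : Fin n → ℝ) :
    Mplus id (fun i => 1 - x i) = Mminus id x := by
  simp only [Mplus, Mminus, pValue_id_one_sub]
  exact Fin.revPerm.iInf_comp (g := fun k => 1 - pValue id x k)

theorem Mplus_comp_monotone {n : ℕ} {F : ℝ → ℝ} (hF : Monotone F) (x : Fin n → ℝ) :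
    Mplus F x = Mplus id (fun i => F (x i)) := by
  simp only [Mplus, pValue_comp_monotone hF]

theorem Mminus_comp_monotone {n : ℕ} {F : ℝ → ℝ} (hF : Monotone F) (x : Fin n → ℝ) :
    Mminus F x = Mminus id (fun i => F (x i)) := by
  simp only [Mminus, pValue_comp_monotone hF]

theorem M_comp_monotone {n : ℕ} {F : ℝ → ℝ} (hF : Monotone F) (x : Fin n → ℝ) :
    M F x = M id (fun i => F (x i)) := by
  simp only [M, Mplus_comp_monotone hF, Mminus_comp_monotone hF]

theorem monotone_Mplus_id {n : ℕ} : Monotone fun x : Fin n → ℝ => Mplus id x :=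
  fun _ _ h => ciInf_mono (Set.finite_range _).bddBelow fun k => monotone_pValue_id k h

theorem antitone_Mminus_id {n : ℕ} : Antitone fun x : Fin n → ℝ => Mminus id x :=
  fun _ _ h => ciInf_mono (Set.finite_range _).bddBelow
    fun k => sub_le_sub_left (monotone_pValue_id k h) 1

theorem measurable_Mplus_id {n : ℕ} : Measurable fun x : Fin n → ℝ => Mplus id x :=
  Measurable.iInf measurable_pValue_id

theorem measurable_Mminus_id {n : ℕ} : Measurable fun x : Fin n → ℝ => Mminus id x :=
  Measurable.iInf fun k => measurable_const.sub (measurable_pValue_id k)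

/-! ### Harris' inequality -/

/-- Chebyshev's association inequality: integrate `(f x - f y) * (g x - g y) ≤ 0` over `x`, then
over `y`. -/
theorem integral_mul_le_of_antitone_of_monotone {μ : Measure ℝ} [IsProbabilityMeasure μ]
    {f g : ℝ → ℝ} (hf : Antitone f) (hg : Monotone g) (hfi : Integrable f μ)
    (hgi : Integrable g μ) (hfg : Integrable (fun x => f x * g x) μ) :
    ∫ x, f x * g x ∂μ ≤ (∫ x, f x ∂μ) * ∫ x, g x ∂μ := by
  have h1 : ∀ y, (∫ x, f x * g x ∂μ) - g y * (∫ x, f x ∂μ) - f y * (∫ x, g x ∂μ) + f y * g y ≤ 0 := by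
    intro y
    have e : ∫ x, (f x * g x - g y * f x - f y * g x + f y * g y) ∂μ =
        (∫ x, f x * g x ∂μ) - g y * (∫ x, f x ∂μ) - f y * (∫ x, g x ∂μ) + f y * g y := by
      rw [integral_add (by exact (hfg.sub (hfi.const_mul _)).sub (hgi.const_mul _))
          (integrable_const _),
        integral_sub (by exact hfg.sub (hfi.const_mul _)) (hgi.const_mul _),
        integral_sub hfg (hfi.const_mul _), integral_const_mul, integral_const_mul]
      simp
    rw [← e]
    refine integral_nonpos fun x => ?_
    have : (f x - f y) * (g x - g y) ≤ 0 := by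
      rcases le_total x y with h | h
      · exact mul_nonpos_of_nonneg_of_nonpos (sub_nonneg.2 (hf h)) (sub_nonpos.2 (hg h))
      · exact mul_nonpos_of_nonpos_of_nonneg (sub_nonpos.2 (hf h)) (sub_nonneg.2 (hg h))
    simp only [Pi.zero_apply]
    linarith
  have h2 := integral_nonpos (μ := μ) h1
  rw [integral_add (by exact ((integrable_const _).sub (hgi.mul_const _)).sub (hfi.mul_const _)) hfg,
    integral_sub (by exact (integrable_const _).sub (hgi.mul_const _)) (hfi.mul_const _),
    integral_sub (integrable_const _) (hgi.mul_const _), integral_mul_const,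
    integral_mul_const] at h2
  simp only [integral_const, probReal_univ, smul_eq_mul, one_mul] at h2
  linarith

theorem integrable_of_mem_Icc {α : Type*} [MeasurableSpace α] {μ : Measure α} [IsFiniteMeasure μ]
    {f : α → ℝ} (hf : Measurable f) (h : ∀ x, f x ∈ Set.Icc (0 : ℝ) 1) : Integrable f μ :=
  Integrable.of_bound hf.aestronglyMeasurable 1
    (ae_of_all _ fun x => by rw [Real.norm_of_nonneg (h x).1]; exact (h x).2)

theorem measurable_finCons {n : ℕ} :
    Measurable fun z : ℝ × (Fin n → ℝ) => (Fin.cons z.1 z.2 : Fin (n + 1) → ℝ) := by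
  refine measurable_pi_iff.2 fun i => ?_
  refine Fin.cases ?_ (fun j => ?_) i
  · simpa using measurable_fst
  · simp only [Fin.cons_succ]
    exact (measurable_pi_apply j).comp measurable_snd

/-- Fubini's theorem for a product measure, integrating out the first coordinate last. -/
theorem integral_pi_succ {μ : Measure ℝ} [IsProbabilityMeasure μ] {n : ℕ}
    {f : (Fin (n + 1) → ℝ) → ℝ} (hf : Measurable f) (h : ∀ x, f x ∈ Set.Icc (0 : ℝ) 1) :
    ∫ x, f x ∂(Measure.pi fun _ => μ) =
      ∫ a, ∫ y : Fin n → ℝ, f (Fin.cons a y) ∂(Measure.pi fun _ => μ) ∂μ := by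
  have hp := (measurePreserving_piFinSuccAbove (fun _ : Fin (n + 1) => μ) 0).symm
  have hc := hp.integral_comp' f
  rw [← hc, integral_prod _ ?_]
  · simp [MeasurableEquiv.piFinSuccAbove_symm_apply, Fin.consEquiv]
  · exact integrable_of_mem_Icc (hf.comp (MeasurableEquiv.measurable _)) fun x => h _

theorem integral_mem_Icc {α : Type*} [MeasurableSpace α] {μ : Measure α} [IsProbabilityMeasure μ]
    {f : α → ℝ} (hf : Measurable f) (h : ∀ x, f x ∈ Set.Icc (0 : ℝ) 1) :
    ∫ x, f x ∂μ ∈ Set.Icc (0 : ℝ) 1 :=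
  ⟨integral_nonneg fun x => (h x).1, by
    simpa using integral_mono (μ := μ) (integrable_of_mem_Icc hf h) (integrable_const 1)
      fun x => (h x).2⟩

theorem finCons_mono {n : ℕ} {a b : ℝ} {y z : Fin n → ℝ} (h : a ≤ b) (h' : y ≤ z) :
    (Fin.cons a y : Fin (n + 1) → ℝ) ≤ Fin.cons b z :=
  Fin.cons_le_cons.2 ⟨h, h'⟩

/-- Harris' inequality for functions: under a product measure, a decreasing and an increasing
function are negatively correlated. -/
theorem integral_pi_mul_le {μ : Measure ℝ} [IsProbabilityMeasure μ] {n : ℕ}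
    {f g : (Fin n → ℝ) → ℝ} (hf : Antitone f) (hg : Monotone g) (hfm : Measurable f)
    (hgm : Measurable g) (hf1 : ∀ x, f x ∈ Set.Icc (0 : ℝ) 1)
    (hg1 : ∀ x, g x ∈ Set.Icc (0 : ℝ) 1) :
    ∫ x, f x * g x ∂(Measure.pi fun _ => μ) ≤
      (∫ x, f x ∂(Measure.pi fun _ => μ)) * ∫ x, g x ∂(Measure.pi fun _ => μ) := by
  have mul01 : ∀ {a b : ℝ}, a ∈ Set.Icc (0 : ℝ) 1 → b ∈ Set.Icc (0 : ℝ) 1 →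
      a * b ∈ Set.Icc (0 : ℝ) 1 :=
    fun ha hb => ⟨mul_nonneg ha.1 hb.1, mul_le_one₀ ha.2 hb.1 hb.2⟩
  induction n with
  | zero =>
    have e : ∀ φ : (Fin 0 → ℝ) → ℝ, ∫ x, φ x ∂(Measure.pi fun _ => μ) = φ default := by
      intro φ
      rw [integral_congr_ae (ae_of_all _ fun x => congrArg φ (Subsingleton.elim x default))]
      simp
    rw [e, e, e]
  | succ n ih =>
    have hmc : ∀ a, Measurable fun y : Fin n → ℝ => (Fin.cons a y : Fin (n + 1) → ℝ) :=
      fun a => measurable_finCons.comp measurable_prodMk_left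
    rw [integral_pi_succ hfm hf1, integral_pi_succ hgm hg1,
      integral_pi_succ (f := fun x => f x * g x) (hfm.mul hgm) fun x => mul01 (hf1 x) (hg1 x)]
    -- Condition on the first coordinate: the induction hypothesis bounds the inner integral by `φ a
    -- * γ a`, and these conditional means inherit monotonicity, so the one-dimensional inequality
    -- finishes.
    set φ := fun a => ∫ y : Fin n → ℝ, f (Fin.cons a y) ∂(Measure.pi fun _ => μ)
    set γ := fun a => ∫ y : Fin n → ℝ, g (Fin.cons a y) ∂(Measure.pi fun _ => μ)
    have hφ : Antitone φ := fun a b hab => integral_mono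
      (integrable_of_mem_Icc (hfm.comp (hmc b)) fun _ => hf1 _)
      (integrable_of_mem_Icc (hfm.comp (hmc a)) fun _ => hf1 _)
      fun y => hf (finCons_mono hab le_rfl)
    have hγ : Monotone γ := fun a b hab => integral_mono
      (integrable_of_mem_Icc (hgm.comp (hmc a)) fun _ => hg1 _)
      (integrable_of_mem_Icc (hgm.comp (hmc b)) fun _ => hg1 _)
      fun y => hg (finCons_mono hab le_rfl)
    have hφ1 : ∀ a, φ a ∈ Set.Icc (0 : ℝ) 1 := fun a => integral_mem_Icc (hfm.comp (hmc a)) fun _ => hf1 _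
    have hγ1 : ∀ a, γ a ∈ Set.Icc (0 : ℝ) 1 := fun a => integral_mem_Icc (hgm.comp (hmc a)) fun _ => hg1 _
    have hφγ : Integrable (fun a => φ a * γ a) μ :=
      integrable_of_mem_Icc (hφ.measurable.mul hγ.measurable) fun a => mul01 (hφ1 a) (hγ1 a)
    refine le_trans (integral_mono_of_nonneg (ae_of_all _ fun a => integral_nonneg fun y =>
      (mul01 (hf1 _) (hg1 _)).1) hφγ (ae_of_all _ fun a => ?_))
      (integral_mul_le_of_antitone_of_monotone hφ hγ
        (integrable_of_mem_Icc hφ.measurable hφ1) (integrable_of_mem_Icc hγ.measurable hγ1) hφγ)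
    exact ih (fun y z h => hf (finCons_mono le_rfl h)) (fun y z h => hg (finCons_mono le_rfl h))
      (hfm.comp (hmc a)) (hgm.comp (hmc a)) (fun _ => hf1 _) (fun _ => hg1 _)

theorem indicator_one_mem_Icc {α : Type*} (s : Set α) (x : α) :
    s.indicator (1 : α → ℝ) x ∈ Set.Icc (0 : ℝ) 1 := by
  by_cases h : x ∈ s <;> simp [h]

/-- Harris' inequality: under a product measure, a lower set and an upper set are negatively
correlated. -/
theorem measureReal_pi_inter_le {μ : Measure ℝ} [IsProbabilityMeasure μ] {n : ℕ}
    {A B : Set (Fin n → ℝ)} (hA : IsLowerSet A) (hB : IsUpperSet B) (hAm : MeasurableSet A)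
    (hBm : MeasurableSet B) :
    (Measure.pi fun _ => μ).real (A ∩ B) ≤
      (Measure.pi fun _ => μ).real A * (Measure.pi fun _ => μ).real B := by
  rw [← integral_indicator_one hAm, ← integral_indicator_one hBm,
    ← integral_indicator_one (hAm.inter hBm), Set.inter_indicator_one]
  refine integral_pi_mul_le (fun x y h => ?_) (fun x y h => ?_) (measurable_one.indicator hAm)
    (measurable_one.indicator hBm) (indicator_one_mem_Icc A) (indicator_one_mem_Icc B)
  · by_cases hy : y ∈ A
    · simp [hy, hA h hy]
    · simpa [hy] using (indicator_one_mem_Icc A x).1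
  · by_cases hx : x ∈ B
    · simp [hx, hB h hx]
    · simpa [hx] using (indicator_one_mem_Icc B y).1

/-! ### Binomial and multinomial counts -/

/-- The binomial probability mass function. -/
def binomPMF (p : ℝ) (n i : ℕ) : ℝ := (n.choose i : ℝ) * p ^ i * (1 - p) ^ (n - i)

/-- The probability that a binomial variable with parameters `n` and `p` is less than `k`. -/
def binomLT (p : ℝ) (n k : ℕ) : ℝ :=
  ∑ i ∈ Finset.range k, binomPMF p n i

theorem binomPMF_nonneg {p : ℝ} (hp : p ∈ Set.Icc (0 : ℝ) 1) (n i : ℕ) :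
    0 ≤ binomPMF p n i :=
  mul_nonneg (mul_nonneg (Nat.cast_nonneg _) (pow_nonneg hp.1 _)) (pow_nonneg (sub_nonneg.2 hp.2) _)

theorem binomLT_nonneg {p : ℝ} (hp : p ∈ Set.Icc (0 : ℝ) 1) (n k : ℕ) : 0 ≤ binomLT p n k :=
  Finset.sum_nonneg fun i _ => binomPMF_nonneg hp n i

theorem binomLT_le_succ {p : ℝ} (hp : p ∈ Set.Icc (0 : ℝ) 1) (n k : ℕ) :
    binomLT p n k ≤ binomLT p n (k + 1) := by
  rw [binomLT, binomLT, Finset.sum_range_succ]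
  exact le_add_of_nonneg_right (binomPMF_nonneg hp n k)

theorem binomLT_zero_succ (p : ℝ) (k : ℕ) : binomLT p 0 (k + 1) = 1 := by
  rw [binomLT, Finset.sum_range_succ']
  simp [binomPMF]

/-- Condition on one trial: a success lowers the remaining threshold by one. -/
theorem binomLT_succ_succ (p : ℝ) (n k : ℕ) :
    binomLT p (n + 1) (k + 1) = p * binomLT p n k + (1 - p) * binomLT p n (k + 1) := by
  simp only [binomLT, binomPMF]
  rw [Finset.sum_range_succ', Finset.sum_range_succ' _ k, mul_add, ← add_assoc, Finset.mul_sum,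
    Finset.mul_sum, ← Finset.sum_add_distrib]
  congr 1
  · refine Finset.sum_congr rfl fun i _ => ?_
    rw [Nat.choose_succ_succ, Nat.add_sub_add_right]
    -- For `i ≥ n` the subtraction `n - (i + 1)` truncates, but its binomial coefficient vanishes.
    rcases lt_or_ge i n with h | h
    · obtain ⟨d, rfl⟩ := Nat.exists_eq_add_of_lt h
      rw [show i + d + 1 - i = d + 1 by omega, show i + d + 1 - (i + 1) = d by omega]
      push_cast; ring
    · rw [Nat.choose_eq_zero_of_lt (by omega : n < i + 1), Nat.sub_eq_zero_of_le h]
      push_cast; ring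
  · simp; ring

/-- A Weierstrass product inequality. The left side, where at most one factor is decreased, models
one observation falling into at most one of several disjoint sets; the right side treats the sets as
independent. -/
theorem prod_sub_sum_le_prod_sub {ι : Type*} [DecidableEq ι] (s : Finset ι) {b d : ι → ℝ}
    (hd : ∀ i ∈ s, 0 ≤ d i) (hdb : ∀ i ∈ s, d i ≤ b i) :
    ∏ i ∈ s, b i - ∑ j ∈ s, d j * ∏ i ∈ s.erase j, b i ≤ ∏ i ∈ s, (b i - d i) := by
  induction s using Finset.induction_on with
  | empty => simp
  | insert a s ha ih =>
    have hd' : ∀ i ∈ s, 0 ≤ d i := fun i hi => hd i (Finset.mem_insert_of_mem hi)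
    have hdb' : ∀ i ∈ s, d i ≤ b i := fun i hi => hdb i (Finset.mem_insert_of_mem hi)
    have ih := ih hd' hdb'
    have hda := hd a (Finset.mem_insert_self a s)
    have hba := hdb a (Finset.mem_insert_self a s)
    have hR : ∏ i ∈ s, (b i - d i) ≤ ∏ i ∈ s, b i :=
      Finset.prod_le_prod (fun i hi => sub_nonneg.2 (hdb' i hi))
        fun i hi => sub_le_self _ (hd' i hi)
    have hsum : ∑ j ∈ s, d j * ∏ i ∈ (insert a s).erase j, b i =
        b a * ∑ j ∈ s, d j * ∏ i ∈ s.erase j, b i := by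
      rw [Finset.mul_sum]
      refine Finset.sum_congr rfl fun j hj => ?_
      have hja : a ≠ j := fun h => ha (h ▸ hj)
      rw [Finset.erase_insert_of_ne hja,
        Finset.prod_insert fun h => ha (Finset.mem_of_mem_erase h)]
      ring
    rw [Finset.prod_insert ha, Finset.prod_insert ha, Finset.sum_insert ha,
      Finset.erase_insert ha, hsum]
    have h1 := mul_le_mul_of_nonneg_left ih (hda.trans hba)
    have h2 := mul_le_mul_of_nonneg_left hR hda
    linarith

open Classical in
/-- The number of observations in `s`. -/
def count {n : ℕ} (s : Set ℝ) (x : Fin n → ℝ) : ℕ :=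
  ∑ i, if x i ∈ s then 1 else 0

theorem measurable_count {n : ℕ} {s : Set ℝ} (hs : MeasurableSet s) :
    Measurable (count s : (Fin n → ℝ) → ℕ) :=
  Finset.measurable_sum _ fun i _ =>
    Measurable.ite (measurable_pi_apply i hs) measurable_const measurable_const

open Classical in
theorem count_cons {n : ℕ} (s : Set ℝ) (a : ℝ) (y : Fin n → ℝ) :
    count s (Fin.cons a y : Fin (n + 1) → ℝ) = (if a ∈ s then 1 else 0) + count s y := by
  simp only [count, Fin.sum_univ_succ, Fin.cons_zero, Fin.cons_succ]

theorem count_le_card {n : ℕ} {s : Set ℝ} {u : ℝ} (hs : s ⊆ Set.Iic u) (x : Fin n → ℝ) :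
    count s x ≤ Fintype.card {i // x i ≤ u} := by
  rw [Fintype.card_subtype, Finset.card_filter]
  refine Finset.sum_le_sum fun i _ => ?_
  by_cases h : x i ∈ s
  · simp [h, Set.mem_Iic.1 (hs h)]
  · simp [h]

/-- Multinomial counts are negatively dependent: the probability that all of them are small is at
most the product of the binomial probabilities. -/
theorem measureReal_forall_count_lt_le {ι : Type*} [Fintype ι] {μ : Measure ℝ}
    [IsProbabilityMeasure μ] {I : ι → Set ℝ} (hI : ∀ j, MeasurableSet (I j))
    (hd : Pairwise fun i j => Disjoint (I i) (I j)) (n : ℕ) (k : ι → ℕ) :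
    (Measure.pi fun _ => μ).real {x : Fin n → ℝ | ∀ j, count (I j) x < k j} ≤
      ∏ j, binomLT (μ.real (I j)) n (k j) := by
  classical
  have hp : ∀ j, μ.real (I j) ∈ Set.Icc (0 : ℝ) 1 :=
    fun j => ⟨measureReal_nonneg, measureReal_le_one⟩
  have hms : ∀ (n : ℕ) (k : ι → ℕ), MeasurableSet {x : Fin n → ℝ | ∀ j, count (I j) x < k j} := by
    intro n k
    simp only [Set.ofPred_forall]
    exact MeasurableSet.iInter fun j => measurable_count (hI j) (measurableSet_Iio (a := k j))
  induction n generalizing k with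
  | zero =>
    by_cases hk : ∃ j, k j = 0
    · obtain ⟨j, hj⟩ := hk
      have : {x : Fin 0 → ℝ | ∀ j, count (I j) x < k j} = ∅ := by
        ext x; simpa using ⟨j, by simp [hj]⟩
      rw [this, measureReal_empty]
      exact Finset.prod_nonneg fun j _ => binomLT_nonneg (hp j) _ _
    · push Not at hk
      have : ∏ j, binomLT (μ.real (I j)) 0 (k j) = 1 := Finset.prod_eq_one fun j _ => by
        obtain ⟨m, hm⟩ := Nat.exists_eq_succ_of_ne_zero (hk j)
        rw [hm, Nat.succ_eq_add_one, binomLT_zero_succ]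
      rw [this]
      exact measureReal_le_one
  | succ n ih =>
    by_cases hk : ∃ j, k j = 0
    · obtain ⟨j, hj⟩ := hk
      have : {x : Fin (n + 1) → ℝ | ∀ j, count (I j) x < k j} = ∅ := by
        ext x; simpa using ⟨j, by simp [hj]⟩
      rw [this, measureReal_empty]
      exact Finset.prod_nonneg fun j _ => binomLT_nonneg (hp j) _ _
    push Not at hk
    choose m hm using fun j => Nat.exists_eq_succ_of_ne_zero (hk j)
    obtain rfl : k = fun j => m j + 1 := funext hm
    clear hk hm
    set p : ι → ℝ := fun j => μ.real (I j) with hp'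
    set b : ι → ℝ := fun j => binomLT (p j) n (m j + 1) with hb
    set a : ι → ℝ := fun j => binomLT (p j) n (m j) with ha
    set S := {x : Fin (n + 1) → ℝ | ∀ j, count (I j) x < m j + 1} with hS
    -- Condition on the first observation `z`. By disjointness it lies in at most one `I j`; if it
    -- does, that threshold drops by one and the factor `b j` becomes `a j`. Otherwise no factor
    -- changes.
    have hbound : ∀ z : ℝ, ∫ y : Fin n → ℝ, S.indicator 1 (Fin.cons z y : Fin (n + 1) → ℝ)
        ∂(Measure.pi fun _ => μ) ≤
          ∏ j, b j - ∑ j, (I j).indicator 1 z * ((b j - a j) * ∏ i ∈ Finset.univ.erase j, b i) := by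
      intro z
      by_cases hz : ∃ j, z ∈ I j
      · obtain ⟨j, hj⟩ := hz
        have hne : ∀ i, i ≠ j → z ∉ I i := fun i hi h =>
          Set.disjoint_left.1 (hd hi) h hj
        have e1 : (fun y : Fin n → ℝ => S.indicator (1 : (Fin (n + 1) → ℝ) → ℝ) (Fin.cons z y : Fin (n + 1) → ℝ)) =
            {y : Fin n → ℝ | ∀ i, count (I i) y <
              (Function.update (fun i => m i + 1) j (m j)) i}.indicator 1 := by
          ext y
          have : (Fin.cons z y : Fin (n + 1) → ℝ) ∈ S ↔ y ∈ {y : Fin n → ℝ | ∀ i, count (I i) y <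
              (Function.update (fun i => m i + 1) j (m j)) i} := by
            simp only [hS, Set.mem_ofPred_eq]
            refine forall_congr' fun i => ?_
            rcases eq_or_ne i j with rfl | hi
            · simp [count_cons, hj, add_comm 1]
            · simp [count_cons, hne i hi, hi]
          by_cases h : y ∈ {y : Fin n → ℝ | ∀ i, count (I i) y <
              (Function.update (fun i => m i + 1) j (m j)) i}
          · rw [Set.indicator_of_mem h, Set.indicator_of_mem (this.2 h)]; rfl
          · rw [Set.indicator_of_notMem h, Set.indicator_of_notMem fun h' => h (this.1 h')]
        rw [e1, integral_indicator_one (hms _ _)]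
        refine (ih _).trans (le_of_eq ?_)
        rw [Finset.sum_eq_single j (fun i _ hi => by simp [hne i hi]) (by simp),
          ← Finset.mul_prod_erase _ _ (Finset.mem_univ j),
          ← Finset.mul_prod_erase _ b (Finset.mem_univ j)]
        have : ∏ i ∈ Finset.univ.erase j, binomLT (p i) n
            (Function.update (fun i => m i + 1) j (m j) i) = ∏ i ∈ Finset.univ.erase j, b i :=
          Finset.prod_congr rfl fun i hi => by simp [hb, Finset.ne_of_mem_erase hi]
        rw [this]
        simp only [Function.update_self, Set.indicator_of_mem hj, Pi.one_apply, ha]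
        ring
      · push Not at hz
        have e1 : (fun y : Fin n → ℝ => S.indicator (1 : (Fin (n + 1) → ℝ) → ℝ) (Fin.cons z y : Fin (n + 1) → ℝ)) =
            {y : Fin n → ℝ | ∀ i, count (I i) y < m i + 1}.indicator 1 := by
          ext y
          simp [Set.indicator, hS, count_cons, hz]
        rw [e1, integral_indicator_one (hms _ _)]
        refine (ih _).trans (le_of_eq ?_)
        simp [hz, hb, hp']
    have hci : ∀ j, Integrable (fun z => (I j).indicator (1 : ℝ → ℝ) z *
        ((b j - a j) * ∏ i ∈ Finset.univ.erase j, b i)) μ := fun j =>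
      (integrable_of_mem_Icc (measurable_one.indicator (hI j))
        (indicator_one_mem_Icc (I j))).mul_const _
    rw [← integral_indicator_one (hms _ _), integral_pi_succ
      (measurable_one.indicator (hms _ _)) (indicator_one_mem_Icc _)]
    have hBi : Integrable (fun z => ∏ j, b j - ∑ j, (I j).indicator (1 : ℝ → ℝ) z *
        ((b j - a j) * ∏ i ∈ Finset.univ.erase j, b i)) μ :=
      (integrable_const _).sub (integrable_finsetSum _ fun j _ => hci j)
    refine (integral_mono_of_nonneg (ae_of_all _ fun z => integral_nonneg fun y =>
      (indicator_one_mem_Icc _ _).1) hBi (ae_of_all _ hbound)).trans ?_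
    rw [integral_sub (integrable_const _) (integrable_finsetSum _ fun j _ => hci j),
      integral_finsetSum _ fun j _ => hci j]
    simp only [integral_mul_const, integral_indicator_one (hI _), integral_const, probReal_univ,
      smul_eq_mul, one_mul]
    have hab : ∀ j, a j ≤ b j := fun j => binomLT_le_succ (hp j) _ _
    have ha0 : ∀ j, 0 ≤ a j := fun j => binomLT_nonneg (hp j) _ _
    -- The resulting factors `b j - p j * (b j - a j)` are exactly those of the recursion
    -- `binomLT_succ_succ`.
    have h := prod_sub_sum_le_prod_sub Finset.univ (b := b) (d := fun j => p j * (b j - a j))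
      (fun j _ => mul_nonneg (hp j).1 (sub_nonneg.2 (hab j)))
      (fun j _ => (mul_le_of_le_one_left (sub_nonneg.2 (hab j)) (hp j).2).trans
        (sub_le_self _ (ha0 j)))
    simp only [mul_assoc] at h ⊢
    refine h.trans (le_of_eq (Finset.prod_congr rfl fun j _ => ?_))
    rw [binomLT_succ_succ]
    simp only [hb, ha]
    ring

/-! ### Anticoncentration of the binomial distribution -/

theorem binomPMF_eq_eval (p : ℝ) (n i : ℕ) :
    binomPMF p n i = (bernsteinPolynomial ℝ n i).eval p := by
  simp [binomPMF, bernsteinPolynomial]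

theorem sum_binomPMF (p : ℝ) (n : ℕ) : ∑ i ∈ Finset.range (n + 1), binomPMF p n i = 1 := by
  simpa [Polynomial.eval_finsetSum, binomPMF_eq_eval] using
    congrArg (Polynomial.eval p) (bernsteinPolynomial.sum ℝ n)

theorem sum_sq_mul_binomPMF (p : ℝ) (n : ℕ) :
    ∑ i ∈ Finset.range (n + 1), (n * p - i) ^ 2 * binomPMF p n i = n * p * (1 - p) := by
  simpa [Polynomial.eval_finsetSum, binomPMF_eq_eval] using
    congrArg (Polynomial.eval p) (bernsteinPolynomial.variance ℝ n)

theorem binomPMF_succ (p : ℝ) {n i : ℕ} (hi : i < n) :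
    (i + 1) * ((1 - p) * binomPMF p n (i + 1)) = (n - i) * p * binomPMF p n i := by
  have h := congrArg (Nat.cast (R := ℝ)) (Nat.choose_succ_right_eq n i)
  push_cast [Nat.cast_sub hi.le] at h
  obtain ⟨d, rfl⟩ := Nat.exists_eq_add_of_lt hi
  simp only [binomPMF]
  rw [show i + d + 1 - i = d + 1 by omega, show i + d + 1 - (i + 1) = d by omega]
  push_cast at h ⊢
  linear_combination (1 - p) ^ (d + 1) * p ^ (i + 1) * h

/-- The ratio of successive masses is `(n - i) p / ((i + 1) (1 - p))`. Bounding `1 - p` by `1`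
avoids dividing by it. -/
theorem mul_binomPMF_le_succ {p : ℝ} (hp : p ∈ Set.Icc (0 : ℝ) 1) {n i : ℕ} (hi : i < n) {r : ℝ}
    (hr : r * (i + 1) ≤ (n - i) * p) : r * binomPMF p n i ≤ binomPMF p n (i + 1) := by
  have h0 : 0 ≤ binomPMF p n i := binomPMF_nonneg hp n i
  have h1 : 0 ≤ binomPMF p n (i + 1) := binomPMF_nonneg hp n (i + 1)
  have hi' : (0 : ℝ) < i + 1 := by positivity
  refine le_of_mul_le_mul_left ?_ hi'
  calc (i + 1 : ℝ) * (r * binomPMF p n i) = r * (i + 1) * binomPMF p n i := by ring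
    _ ≤ (n - i) * p * binomPMF p n i := mul_le_mul_of_nonneg_right hr h0
    _ = (i + 1) * ((1 - p) * binomPMF p n (i + 1)) := (binomPMF_succ p hi).symm
    _ ≤ (i + 1) * binomPMF p n (i + 1) := mul_le_mul_of_nonneg_left
        (mul_le_of_le_one_left h1 (by linarith [hp.1])) hi'.le

theorem pow_mul_binomPMF_le_add {p : ℝ} (hp : p ∈ Set.Icc (0 : ℝ) 1) {n i R : ℕ}
    (hi : i + R ≤ n) {r : ℝ} (hr0 : 0 ≤ r)
    (hr : ∀ l < i + R, r * (l + 1) ≤ (n - l) * p) :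
    r ^ R * binomPMF p n i ≤ binomPMF p n (i + R) := by
  induction R with
  | zero => simp
  | succ R ih =>
    have h1 := ih (by omega) fun l hl => hr l (by omega)
    have h2 := mul_binomPMF_le_succ hp (n := n) (i := i + R) (by omega) (r := r)
      (by exact_mod_cast hr (i + R) (by omega))
    calc r ^ (R + 1) * binomPMF p n i = r * (r ^ R * binomPMF p n i) := by ring
      _ ≤ r * binomPMF p n (i + R) := mul_le_mul_of_nonneg_left h1 hr0
      _ ≤ _ := h2

/-- By Chebyshev's inequality, at least `3 / 4` of the mass of the binomial distribution is near
its mean. -/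
theorem three_quarters_le_sum_binomPMF {p : ℝ} (hp : p ∈ Set.Icc (0 : ℝ) 1) {n s : ℕ}
    (hs : 0 < s) (h1 : (s : ℝ) ^ 2 - 2 * s ≤ n * p) (h2 : n * p ≤ (s : ℝ) ^ 2) :
    3 / 4 ≤ ∑ i ∈ Finset.range (n + 1) with s ^ 2 ≤ i + 4 * s ∧ i ≤ s ^ 2 + 2 * s,
      binomPMF p n i := by
  have hsum := sum_binomPMF p n
  rw [← Finset.sum_filter_add_sum_filter_not _
    (fun i => s ^ 2 ≤ i + 4 * s ∧ i ≤ s ^ 2 + 2 * s)] at hsum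
  have hs' : (0 : ℝ) < s := Nat.cast_pos.2 hs
  have hvar : 4 * (s : ℝ) ^ 2 * ∑ i ∈ Finset.range (n + 1) with
      ¬ (s ^ 2 ≤ i + 4 * s ∧ i ≤ s ^ 2 + 2 * s), binomPMF p n i ≤ (s : ℝ) ^ 2 := by
    calc _ ≤ ∑ i ∈ Finset.range (n + 1) with ¬ (s ^ 2 ≤ i + 4 * s ∧ i ≤ s ^ 2 + 2 * s),
          (n * p - i) ^ 2 * binomPMF p n i := by
          rw [Finset.mul_sum]
          refine Finset.sum_le_sum fun i hi => mul_le_mul_of_nonneg_right ?_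
            (binomPMF_nonneg hp n i)
          rw [Finset.mem_filter, not_and_or, not_le, not_le] at hi
          -- The mean lies in `[s² - 2s, s²]`, so leaving `[s² - 4s, s² + 2s]` on either side means
          -- being more than `2s` from it.
          rcases hi.2 with h | h
          · have : (i : ℝ) + 4 * s < s ^ 2 := by exact_mod_cast h
            nlinarith
          · have : (s : ℝ) ^ 2 + 2 * s < i := by exact_mod_cast h
            nlinarith
      _ ≤ ∑ i ∈ Finset.range (n + 1), (n * p - i) ^ 2 * binomPMF p n i :=
          Finset.sum_le_sum_of_subset_of_nonneg (Finset.filter_subset _ _)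
            fun i _ _ => mul_nonneg (sq_nonneg _) (binomPMF_nonneg hp n i)
      _ = n * p * (1 - p) := sum_sq_mul_binomPMF p n
      _ ≤ n * p := mul_le_of_le_one_right (mul_nonneg (Nat.cast_nonneg n) hp.1) (by linarith [hp.1])
      _ ≤ _ := h2
  have : ∑ i ∈ Finset.range (n + 1) with
      ¬ (s ^ 2 ≤ i + 4 * s ∧ i ≤ s ^ 2 + 2 * s), binomPMF p n i ≤ 1 / 4 := by
    have hpos : (0 : ℝ) < s ^ 2 := by positivity
    nlinarith
  linarith

theorem exp_neg_two_mul_le {x : ℝ} (h0 : 0 ≤ x) (h1 : x ≤ 1 / 2) : Real.exp (-(2 * x)) ≤ 1 - x := by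
  rw [Real.exp_neg]
  refine inv_le_of_inv_le₀ (by linarith) (le_trans ?_ (Real.add_one_le_exp _))
  rw [inv_le_iff_one_le_mul₀ (by linarith)]
  nlinarith

/-- A binomial variable with mean about `s ^ 2 - s` exceeds `s ^ 2 + T * s` with probability
bounded below, uniformly in `s`. -/
theorem binomLT_le_of_large {T s n : ℕ} (hs : 2 * (T + 9) ≤ s) (hn : s ^ 2 * (s + T + 6) ≤ n) :
    binomLT (((s : ℝ) ^ 2 - s) / (n + 1)) n (s ^ 2 + T * s) ≤
      1 - 3 / 4 * Real.exp (-(2 * (T + 9) * (T + 4))) := by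
  set p := ((s : ℝ) ^ 2 - s) / (n + 1) with hpdef
  have hs0 : 0 < s := by omega
  have hs1 : (1 : ℝ) ≤ s := by exact_mod_cast hs0
  have hsR : 2 * ((T : ℝ) + 9) ≤ s := by exact_mod_cast hs
  have hnR : (s : ℝ) ^ 2 * (s + T + 6) ≤ n := by exact_mod_cast hn
  have hn1 : (0 : ℝ) < n + 1 := by positivity
  have hT : (0 : ℝ) ≤ T := Nat.cast_nonneg T
  have hpn : p * (n + 1) = (s : ℝ) ^ 2 - s := div_mul_cancel₀ _ hn1.ne'
  have hp0 : 0 ≤ p := div_nonneg (by nlinarith) hn1.le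
  have hp1 : p ≤ 1 := by
    rw [hpdef, div_le_one hn1]
    nlinarith [sq_nonneg (s : ℝ)]
  -- This is where `n` must be large: for indices up to `s (s + T + 6)`, replacing `n + 1` by `n -
  -- l` costs the mean at most `s`.
  have hsp : ((s : ℝ) * (s + T + 6)) * p ≤ s := by
    rw [hpdef, mul_div_assoc', div_le_iff₀ hn1]
    have : (s : ℝ) ^ 2 - s ≤ s ^ 2 := by linarith
    calc (s : ℝ) * (s + T + 6) * (s ^ 2 - s) ≤ (s : ℝ) * (s + T + 6) * (s : ℝ) ^ 2 := by gcongr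
      _ = (s : ℝ) * ((s : ℝ) ^ 2 * (s + T + 6)) := by ring
      _ ≤ (s : ℝ) * (n + 1) := by gcongr; linarith
  have hnp : ∀ l : ℕ, (l : ℝ) + 1 ≤ s * (s + T + 6) → (s : ℝ) ^ 2 - 2 * s ≤ (n - l) * p := by
    intro l hl
    have := mul_le_mul_of_nonneg_right hl hp0
    nlinarith
  have hwin := three_quarters_le_sum_binomPMF ⟨hp0, hp1⟩ (n := n) hs0
    (by simpa using hnp 0 (by simp; nlinarith)) (by nlinarith)
  set W := {i ∈ Finset.range (n + 1) | s ^ 2 ≤ i + 4 * s ∧ i ≤ s ^ 2 + 2 * s} with hW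
  -- The shift that carries the lower end `s² - 4s` of the window to `s² + T s`; the upper end goes
  -- to `s (s + T + 6)`.
  set R := (T + 4) * s with hR
  have hRn : s ^ 2 + 2 * s + R ≤ n := by
    have : s ^ 2 + 2 * s + R = s * (s + T + 6) := by rw [hR]; ring
    rw [this]
    refine le_trans ?_ hn
    exact Nat.mul_le_mul_right _ (Nat.le_self_pow two_ne_zero s)
  -- A lower bound for every mass ratio met along the shift, since `(s - T - 9) (s + T + 6) ≤ s² -
  -- 2s`. As `R` is proportional to `s`, the scale cancels from the bound on `r ^ R`.
  set r : ℝ := 1 - (T + 9) / s with hr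
  have hx : ((T : ℝ) + 9) / s ≤ 1 / 2 := by
    rw [div_le_div_iff₀ (by linarith) two_pos]; linarith
  have hr0 : 0 ≤ r := by rw [hr]; linarith
  have hrs : r * s = s - T - 9 := by rw [hr]; field_simp; ring
  have hrR : Real.exp (-(2 * (T + 9) * (T + 4))) ≤ r ^ R := by
    have h := pow_le_pow_left₀ (Real.exp_nonneg _)
      (exp_neg_two_mul_le (x := ((T : ℝ) + 9) / s) (by positivity) hx) R
    refine le_trans (le_of_eq ?_) h
    rw [← Real.exp_nat_mul, hR]
    congr 1
    push_cast
    field_simp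
  have hshift : ∀ i ∈ W, Real.exp (-(2 * (T + 9) * (T + 4))) * binomPMF p n i ≤
      binomPMF p n (i + R) := by
    intro i hi
    rw [hW, Finset.mem_filter] at hi
    refine le_trans (mul_le_mul_of_nonneg_right hrR (binomPMF_nonneg ⟨hp0, hp1⟩ n i))
      (pow_mul_binomPMF_le_add ⟨hp0, hp1⟩ (by omega) hr0 fun l hl => ?_)
    have hl' : (l : ℝ) + 1 ≤ s * (s + T + 6) := by
      have : l + 1 ≤ s * (s + T + 6) := by
        have : s ^ 2 + 2 * s + R = s * (s + T + 6) := by rw [hR]; ring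
        omega
      exact_mod_cast this
    refine le_trans ?_ (hnp l hl')
    calc r * (l + 1) ≤ r * (s * (s + T + 6)) := mul_le_mul_of_nonneg_left hl' hr0
      _ = (s - T - 9) * (s + T + 6) := by rw [← mul_assoc, hrs]
      _ ≤ _ := by nlinarith
  have htail : binomLT p n (s ^ 2 + T * s) + ∑ i ∈ W, binomPMF p n (i + R) ≤ 1 := by
    have e : ∑ i ∈ W, binomPMF p n (i + R) =
        ∑ i ∈ W.map (addRightEmbedding R), binomPMF p n i := by
      rw [Finset.sum_map]; rfl
    have hRs : R = T * s + 4 * s := by rw [hR]; ring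
    have hdisj : Disjoint (Finset.range (s ^ 2 + T * s)) (W.map (addRightEmbedding R)) := by
      rw [Finset.disjoint_left]
      intro i hi hi'
      rw [Finset.mem_map] at hi'
      obtain ⟨l, hl, rfl⟩ := hi'
      rw [hW, Finset.mem_filter] at hl
      simp only [addRightEmbedding_apply, Finset.mem_range] at hi
      omega
    rw [e, ← sum_binomPMF p n]
    change ∑ i ∈ Finset.range (s ^ 2 + T * s), binomPMF p n i + _ ≤ _
    rw [← Finset.sum_union hdisj]
    refine Finset.sum_le_sum_of_subset_of_nonneg (fun i hi => ?_)
      fun i _ _ => binomPMF_nonneg ⟨hp0, hp1⟩ n i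
    rw [Finset.mem_union, Finset.mem_map] at hi
    rw [Finset.mem_range]
    rcases hi with hi | ⟨l, hl, rfl⟩
    · rw [Finset.mem_range] at hi
      omega
    · rw [hW, Finset.mem_filter] at hl
      simp only [addRightEmbedding_apply]
      omega
  have h1 := Finset.sum_le_sum hshift
  rw [← Finset.mul_sum] at h1
  have h2 := mul_le_mul_of_nonneg_left hwin (Real.exp_nonneg (-(2 * (T + 9) * (T + 4))))
  linarith

/-! ### The probability integral transform -/

/-- The uniform distribution on the unit interval. -/
def unif : Measure ℝ := volume.restrict (Set.Icc 0 1)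

instance isProbabilityMeasure_unif : IsProbabilityMeasure unif := ⟨by simp [unif]⟩

theorem unif_real_Ioc {a b : ℝ} (ha : 0 ≤ a) (hab : a ≤ b) (hb : b ≤ 1) :
    unif.real (Set.Ioc a b) = b - a := by
  rw [unif, measureReal_restrict_apply measurableSet_Ioc,
    Set.inter_eq_left.2 (Set.Ioc_subset_Icc_self.trans (Set.Icc_subset_Icc ha hb))]
  simp [hab]

theorem unif_Iic {a : ℝ} (h1 : a ≤ 1) : unif (Set.Iic a) = ENNReal.ofReal a := by
  rw [unif, Measure.restrict_apply measurableSet_Iic]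
  have : Set.Iic a ∩ Set.Icc 0 1 = Set.Icc 0 a := by
    ext x
    simp only [Set.mem_inter_iff, Set.mem_Iic, Set.mem_Icc]
    exact ⟨fun h => ⟨h.2.1, h.1⟩, fun h => ⟨h.2, h.1, h.2.trans h1⟩⟩
  simp [this]

theorem ae_unif_pos : ∀ᵐ x ∂unif, 0 < x := by
  rw [ae_iff]
  have : {x : ℝ | ¬ 0 < x} = Set.Iic 0 := by ext; simp
  rw [this, unif_Iic zero_le_one, ENNReal.ofReal_zero]

theorem exists_cdf_eq (ν : Measure ℝ) (hF : Continuous (cdf ν)) {a : ℝ} (h0 : 0 < a)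
    (h1 : a < 1) : ∃ x, cdf ν x = a :=
  mem_range_of_exists_le_of_exists_ge hF
    (((tendsto_cdf_atBot ν).eventually_lt_const h0).exists.imp fun _ h => h.le)
    (((tendsto_cdf_atTop ν).eventually_const_lt h1).exists.imp fun _ h => h.le)

/-- The distribution function may have flat pieces, so `{F ≤ a}` can extend beyond a chosen `x` with
`F x = a`. The upper bound therefore uses levels `b ↓ a`. -/
theorem measure_cdf_le (ν : Measure ℝ) [IsProbabilityMeasure ν] (hF : Continuous (cdf ν)) {a : ℝ}
    (h0 : 0 ≤ a) (h1 : a < 1) : ν {x | cdf ν x ≤ a} = ENNReal.ofReal a := by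
  refine le_antisymm ?_ ?_
  · have hb : ∀ b ∈ Set.Ioo a 1, ν {x | cdf ν x ≤ a} ≤ ENNReal.ofReal b := by
      intro b hb
      obtain ⟨x, hx⟩ := exists_cdf_eq ν hF (h0.trans_lt hb.1) hb.2
      rw [← hx, ofReal_cdf]
      refine measure_mono fun y hy => ?_
      by_contra hxy
      have := monotone_cdf ν (not_le.1 hxy).le
      rw [hx] at this
      exact absurd (this.trans hy) (not_le.2 hb.1)
    have hlim : Tendsto (fun b => ENNReal.ofReal b) (𝓝[>] a) (𝓝 (ENNReal.ofReal a)) :=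
      (ENNReal.continuous_ofReal.tendsto a).mono_left nhdsWithin_le_nhds
    exact ge_of_tendsto hlim (Filter.eventually_of_mem (Ioo_mem_nhdsGT h1) hb)
  · rcases h0.eq_or_lt with rfl | h0
    · simp
    · obtain ⟨x, hx⟩ := exists_cdf_eq ν hF h0 h1
      rw [← hx, ofReal_cdf]
      exact measure_mono fun y hy => monotone_cdf ν hy

/-- A random variable with continuous distribution function `F` is made uniform by `F`. -/
theorem map_cdf_eq_unif (ν : Measure ℝ) [IsProbabilityMeasure ν] (hF : Continuous (cdf ν)) :
    ν.map (cdf ν) = unif := by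
  have := Measure.isProbabilityMeasure_map (μ := ν) hF.aemeasurable
  refine Measure.ext_of_Iic _ _ fun a => ?_
  rw [Measure.map_apply hF.measurable measurableSet_Iic]
  rcases lt_or_ge a 0 with h0 | h0
  · have e1 : cdf ν ⁻¹' Set.Iic a = ∅ := by
      ext x; simpa using h0.trans_le (cdf_nonneg ν x)
    have e2 : unif (Set.Iic a) = 0 := le_antisymm
      ((measure_mono (Set.Iic_subset_Iic.2 h0.le)).trans (by simp [unif_Iic])) zero_le
    rw [e1, e2, measure_empty]
  rcases lt_or_ge a 1 with h1 | h1
  · rw [unif_Iic h1.le]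
    exact measure_cdf_le ν hF h0 h1
  · have e1 : cdf ν ⁻¹' Set.Iic a = Set.univ := by
      ext x; simpa using (cdf_le_one ν x).trans h1
    have e2 : unif (Set.Iic a) = 1 := le_antisymm prob_le_one
      (le_trans (by simp [unif_Iic]) (measure_mono (Set.Iic_subset_Iic.2 h1)))
    rw [e1, e2, measure_univ]

/-- Under the null hypothesis the transformed sample consists of independent uniforms. -/
theorem NullSample.hasLaw_cdf {Ω : Type*} [MeasurableSpace Ω] {n : ℕ} {ν : Measure ℝ}
    [IsProbabilityMeasure ν] (hF : Continuous (cdf ν)) {P : Measure Ω} [IsProbabilityMeasure P]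
    {X : Fin n → Ω → ℝ} (hX : NullSample ν P X) :
    HasLaw (fun ω i => cdf ν (X i ω)) (Measure.pi fun _ : Fin n => unif) P := by
  have hm : ∀ i, AEMeasurable (fun ω => cdf ν (X i ω)) P :=
    fun i => hF.measurable.comp_aemeasurable (hX.hasLaw i).aemeasurable
  refine ⟨aemeasurable_pi_iff.2 hm, ?_⟩
  have hind : iIndepFun (fun i ω => cdf ν (X i ω)) P :=
    hX.indep.comp (fun _ => cdf ν) fun _ => hF.measurable
  rw [hind.map_fun_eq_pi_map hm]
  congr 1
  ext1 i
  have h := AEMeasurable.map_map_of_aemeasurable (f := X i) (g := cdf ν) (μ := P)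
    hF.aemeasurable (hX.hasLaw i).aemeasurable
  rw [(hX.hasLaw i).map_eq, map_cdf_eq_unif ν hF] at h
  exact h.symm

theorem measurePreserving_one_sub_unif : MeasurePreserving (fun x : ℝ => 1 - x) unif unif := by
  have h := (Measure.measurePreserving_sub_left (volume : Measure ℝ) 1).restrict_preimage
    (measurableSet_Icc (a := (0 : ℝ)) (b := 1))
  have e : (fun x : ℝ => 1 - x) ⁻¹' Set.Icc 0 1 = Set.Icc 0 1 := by
    simp
  rwa [e] at h

/-! ### Null probabilities for uniform samples -/

theorem measurableSet_Mplus_le (n : ℕ) (c : ℝ) :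
    MeasurableSet {x : Fin n → ℝ | Mplus id x ≤ c} :=
  measurableSet_le measurable_Mplus_id measurable_const

theorem measurableSet_Mminus_le (n : ℕ) (c : ℝ) :
    MeasurableSet {x : Fin n → ℝ | Mminus id x ≤ c} :=
  measurableSet_le measurable_Mminus_id measurable_const

theorem setOf_M_le_eq_union (n : ℕ) (c : ℝ) :
    {x : Fin n → ℝ | M id x ≤ c} = {x | Mplus id x ≤ c} ∪ {x | Mminus id x ≤ c} := by
  ext x
  simp [M]

theorem measureReal_Mminus_le (n : ℕ) (c : ℝ) :
    (Measure.pi fun _ : Fin n => unif).real {x | Mminus id x ≤ c} =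
      (Measure.pi fun _ : Fin n => unif).real {x | Mplus id x ≤ c} := by
  have h := measurePreserving_pi (fun _ : Fin n => unif) (fun _ => unif)
    fun _ => measurePreserving_one_sub_unif
  rw [← h.measureReal_preimage (measurableSet_Mplus_le n c).nullMeasurableSet]
  simp only [Set.preimage_ofPred_eq, Mplus_id_one_sub]

/-- Inclusion-exclusion and Harris' inequality bound the null probability of `M_n ≤ c`. -/
theorem measureReal_M_le_bounds (n : ℕ) (c : ℝ) :
    let q := (Measure.pi fun _ : Fin n => unif).real {x | Mplus id x ≤ c}
    2 * q - q ^ 2 ≤ (Measure.pi fun _ : Fin n => unif).real {x | M id x ≤ c} ∧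
      (Measure.pi fun _ : Fin n => unif).real {x | M id x ≤ c} ≤ 2 * q := by
  intro q
  have hlow : IsLowerSet {x : Fin n → ℝ | Mplus id x ≤ c} :=
    fun x y h hx => (monotone_Mplus_id h).trans hx
  have hupp : IsUpperSet {x : Fin n → ℝ | Mminus id x ≤ c} :=
    fun x y h hx => (antitone_Mminus_id h).trans hx
  have hinter := measureReal_pi_inter_le (μ := unif) hlow hupp (measurableSet_Mplus_le n c)
    (measurableSet_Mminus_le n c)
  have hunion := measureReal_union_add_inter (μ := Measure.pi fun _ : Fin n => unif)
    (s := {x : Fin n → ℝ | Mplus id x ≤ c}) (measurableSet_Mminus_le n c)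
  rw [measureReal_Mminus_le] at hinter hunion
  rw [setOf_M_le_eq_union]
  have hnn := measureReal_nonneg (μ := Measure.pi fun _ : Fin n => unif)
    (s := {x : Fin n → ℝ | Mplus id x ≤ c} ∩ {x | Mminus id x ≤ c})
  change _ ≤ q * q at hinter
  change _ = q + q at hunion
  constructor <;> nlinarith

/-- Almost surely all observations are positive, hence so is every p-value. For `n = 0` this fails:
the empty infimum is `0`. -/
theorem measureReal_Mplus_le_zero {n : ℕ} (hn : 1 ≤ n) :
    (Measure.pi fun _ : Fin n => unif).real {x | Mplus id x ≤ 0} = 0 := by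
  have hpos : ∀ᵐ x ∂(Measure.pi fun _ : Fin n => unif), ∀ i, 0 < x i :=
    ae_all_iff.2 fun i => (measurePreserving_eval (fun _ : Fin n => unif)
      i).quasiMeasurePreserving.ae ae_unif_pos
  rw [measureReal_def, measure_mono_null (fun x hx => ?_) (ae_iff.1 hpos), ENNReal.toReal_zero]
  intro h
  have : Nonempty (Fin n) := ⟨⟨0, hn⟩⟩
  obtain ⟨k, hk⟩ := exists_eq_ciInf_of_finite (f := fun k => pValue id x k)
  have hx' : Mplus id x ≤ 0 := hx
  rw [Mplus, ← hk] at hx'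
  exact absurd hx' (not_le.2
    (betaMeasure_real_Iio_pos (shape_pos k).1 (shape_pos k).2 (h (Tuple.sort x k))))

/-- An excess of small observations forces a small p-value. -/
theorem Mplus_id_le_of_le_count {c : ℝ} {T s n : ℕ} (hT : 1 ≤ T) (hc : 2 ≤ c * T) (hs : 1 ≤ s)
    (hn : s ^ 2 + T * s ≤ n) {x : Fin n → ℝ} {a : ℝ}
    (hx : s ^ 2 + T * s ≤ count (Set.Ioc a ((s : ℝ) ^ 2 / (n + 1))) x) : Mplus id x ≤ c := by
  classical
  have hk0 : 0 < s ^ 2 + T * s := by positivity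
  set k : Fin n := ⟨s ^ 2 + T * s - 1, by omega⟩ with hk
  have hkR : ((k : ℕ) : ℝ) + 1 = (s : ℝ) ^ 2 + T * s := by
    have : (k : ℕ) + 1 = s ^ 2 + T * s := by simp only [hk]; omega
    exact_mod_cast this
  have hT' : (1 : ℝ) ≤ T := by exact_mod_cast hT
  have hs' : (1 : ℝ) ≤ s := by exact_mod_cast hs
  have hn' : (s : ℝ) ^ 2 + T * s ≤ n := by exact_mod_cast hn
  set u : ℝ := (s : ℝ) ^ 2 / (n + 1) with hu
  have hord : orderStat x k ≤ u := by
    rw [orderStat_le_iff]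
    have h1 : count (Set.Ioc a u) x ≤ Fintype.card {i // x i ≤ u} :=
      count_le_card (fun _ h => h.2) x
    have : (k : ℕ) = s ^ 2 + T * s - 1 := rfl
    omega
  have hn1 : (0 : ℝ) < n + 1 := by positivity
  have hsum : ((k : ℕ) : ℝ) + 1 + (n - (k : ℕ)) = n + 1 := by ring
  have hsum' : ((k : ℕ) : ℝ) + 1 + 1 + (n - (k : ℕ)) = n + 2 := by ring
  have hcheb := betaMeasure_real_Iio_mul_le (shape_pos k).1 (shape_pos k).2 (t := u) (by
    rw [hsum, hkR, hu]
    gcongr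
    nlinarith)
  set B := (betaMeasure (((k : ℕ) : ℝ) + 1) (n - (k : ℕ))).real (Set.Iio u)
  have hB0 : 0 ≤ B := measureReal_nonneg
  rw [hsum, hsum', hkR, hu] at hcheb
  have hvar : ((s : ℝ) ^ 2 + T * s) / (n + 1) *
      (((s : ℝ) ^ 2 + T * s + 1) / (n + 2) - ((s : ℝ) ^ 2 + T * s) / (n + 1)) ≤
      ((s : ℝ) ^ 2 + T * s) / (n + 1) ^ 2 := by
    have h1 : ((s : ℝ) ^ 2 + T * s + 1) / (n + 2) - ((s : ℝ) ^ 2 + T * s) / (n + 1) ≤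
        1 / (n + 1) := by
      rw [sub_le_iff_le_add, ← add_div, add_comm 1]
      gcongr
      linarith
    calc _ ≤ ((s : ℝ) ^ 2 + T * s) / (n + 1) * (1 / (n + 1)) := by gcongr
      _ = _ := by field_simp
  -- Chebyshev after clearing `(n + 1)²`: the point `u` lies `T s / (n + 1)` below the beta mean
  -- `(s² + T s) / (n + 1)`.
  have hmain : (T * s : ℝ) ^ 2 * B ≤ (s : ℝ) ^ 2 + T * s := by
    have h := hcheb.trans hvar
    rw [← sub_div, div_pow, div_mul_eq_mul_div, div_le_div_iff_of_pos_right (by positivity)] at h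
    rwa [add_sub_cancel_left] at h
  have hle : (s : ℝ) ^ 2 + T * s ≤ (T * s : ℝ) ^ 2 * c := by
    have h1 : (T * s : ℝ) ^ 2 * c = (T * s ^ 2) * (c * T) := by ring
    have h2 : (T * s ^ 2 : ℝ) * 2 ≤ (T * s ^ 2) * (c * T) := by gcongr
    have h3 : (s : ℝ) ^ 2 ≤ T * s ^ 2 := le_mul_of_one_le_left (by positivity) hT'
    have h4 : (T * s : ℝ) ≤ T * s ^ 2 := by gcongr; nlinarith
    linarith
  have hBc : B ≤ c := le_of_mul_le_mul_left (hmain.trans hle) (by positivity)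
  refine (ciInf_le (Set.finite_range _).bddBelow k).trans (le_trans ?_ hBc)
  exact monotone_betaMeasure_real_Iio (shape_pos k).1 (shape_pos k).2 hord

/-- For fixed `c > 0`, the one-sided statistic falls below `c` with probability tending to one. -/
theorem tendsto_measureReal_Mplus_le {c : ℝ} (hc : 0 < c) :
    Tendsto (fun n : ℕ => (Measure.pi fun _ : Fin n => unif).real {x | Mplus id x ≤ c}) atTop
      (𝓝 1) := by
  obtain ⟨T, hT⟩ := exists_nat_ge (max 1 (2 / c))
  have hT1 : 1 ≤ T := by exact_mod_cast (le_max_left _ _).trans hT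
  have hTc : 2 ≤ c * T := by
    rw [mul_comm, ← div_le_iff₀ hc]
    exact (le_max_right _ _).trans hT
  set δ : ℝ := 3 / 4 * Real.exp (-(2 * (T + 9) * (T + 4))) with hδ
  have hδ0 : 0 < δ := by positivity
  have hδ1 : δ < 1 := by
    have : Real.exp (-(2 * (T + 9) * (T + 4) : ℝ)) ≤ 1 :=
      Real.exp_le_one_iff.2 (neg_nonpos.2 (by positivity))
    linarith
  -- Each scale is the square of the one before, so successive intervals are disjoint; the base
  -- meets the size condition of `binomLT_le_of_large`.
  set s : ℕ → ℕ := fun j => (2 * (T + 9)) ^ 2 ^ j with hs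
  have hsT : ∀ j, 2 * (T + 9) ≤ s j := fun j => Nat.le_self_pow (by positivity) _
  have hss : ∀ {i j}, i < j → s i ^ 2 ≤ s j := by
    intro i j hij
    simp only [hs]
    rw [← pow_mul, ← pow_succ]
    exact Nat.pow_le_pow_right (by positivity) (Nat.pow_le_pow_right two_pos hij)
  -- The number of scales `K` is fixed before `n` grows, so finitely many size conditions on `n`
  -- suffice.
  have hbound : ∀ K : ℕ, ∀ᶠ n : ℕ in atTop,
      1 - (1 - δ) ^ K ≤ (Measure.pi fun _ : Fin n => unif).real {x | Mplus id x ≤ c} := by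
    intro K
    have hev : ∀ᶠ n : ℕ in atTop, ∀ j : Fin K, s j ^ 2 * (s j + T + 6) ≤ n :=
      eventually_all.2 fun j => eventually_ge_atTop _
    filter_upwards [hev] with n hn
    set I : Fin K → Set ℝ := fun j => Set.Ioc ((s j : ℝ) / (n + 1)) ((s j : ℝ) ^ 2 / (n + 1)) with hI
    have hn1 : (0 : ℝ) < n + 1 := by positivity
    have hlt : ∀ i j : Fin K, i < j → Disjoint (I i) (I j) := by
      intro i j hij
      refine Set.disjoint_left.2 fun x hx hx' => ?_
      have h1 : ((s i : ℝ) ^ 2) / (n + 1) ≤ s j / (n + 1) := by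
        gcongr
        exact_mod_cast hss hij
      exact absurd (hx.2.trans h1) (not_le.2 hx'.1)
    have hdisj : Pairwise fun i j => Disjoint (I i) (I j) := fun i j hij =>
      hij.lt_or_gt.elim (hlt i j) fun h => (hlt j i h).symm
    have hsq : ∀ j : Fin K, s j ^ 2 ≤ n := fun j =>
      (Nat.le_mul_of_pos_right _ (by positivity)).trans (hn j)
    have hkn : ∀ j : Fin K, s j ^ 2 + T * s j ≤ n := fun j => by
      refine le_trans ?_ (hn j)
      have h1 : s j ≤ s j ^ 2 := Nat.le_self_pow two_ne_zero _
      nlinarith [hsT j]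
    have hmeas : ∀ j, unif.real (I j) = ((s j : ℝ) ^ 2 - s j) / (n + 1) := by
      intro j
      have h1 : (s j : ℝ) ≤ (s j : ℝ) ^ 2 := by exact_mod_cast Nat.le_self_pow two_ne_zero (s j)
      have h2 : (s j : ℝ) ^ 2 ≤ n := by exact_mod_cast hsq j
      rw [hI, unif_real_Ioc (by positivity) (by gcongr) (by rw [div_le_one hn1]; linarith), sub_div]
    have hnod := measureReal_forall_count_lt_le (μ := unif) (I := I) (fun j => measurableSet_Ioc)
      hdisj n fun j => s j ^ 2 + T * s j
    have hprod : ∏ j, binomLT (unif.real (I j)) n (s j ^ 2 + T * s j) ≤ (1 - δ) ^ K := by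
      refine (Finset.prod_le_prod (fun j _ => binomLT_nonneg ⟨measureReal_nonneg,
        measureReal_le_one⟩ _ _) (g := fun _ => 1 - δ) fun j _ => ?_).trans (by simp)
      rw [hmeas]
      exact binomLT_le_of_large (hsT j) (hn j)
    have hcompl : (Measure.pi fun _ : Fin n => unif).real {x | Mplus id x ≤ c}ᶜ ≤
        (Measure.pi fun _ : Fin n => unif).real
          {x : Fin n → ℝ | ∀ j, count (I j) x < s j ^ 2 + T * s j} := by
      refine measureReal_mono fun x hx j => ?_
      by_contra hj
      exact hx (Mplus_id_le_of_le_count hT1 hTc (le_trans (by omega) (hsT j)) (hkn j)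
        (not_lt.1 hj))
    rw [probReal_compl_eq_one_sub (measurableSet_Mplus_le n c)] at hcompl
    linarith
  refine tendsto_order.2 ⟨fun b hb => ?_, fun b hb => Eventually.of_forall fun n =>
    measureReal_le_one.trans_lt hb⟩
  obtain ⟨K, hK⟩ := exists_pow_lt_of_lt_one (sub_pos.2 hb) (by linarith : 1 - δ < 1)
  filter_upwards [hbound K] with n hn
  linarith

end BerkJones

end

theorem theorem5
    -- the null distribution, with continuous distribution function
    (ν : Measure ℝ) [IsProbabilityMeasure ν] (hF : Continuous (cdf ν))
    -- for every sample size `n`, a sample drawn under the null hypothesis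
    {Ω : ℕ → Type*} [∀ n, MeasurableSpace (Ω n)] (P : ∀ n, Measure (Ω n))
    [∀ n, IsProbabilityMeasure (P n)] (X : ∀ n, Fin n → Ω n → ℝ)
    (hX : ∀ n, BerkJones.NullSample ν (P n) (X n))
    (c : ℝ) (hc : c ∈ Set.Icc (0 : ℝ) 1)
    -- `q n` is the null probability that `M_n^+ ≤ c`
    (q : ℕ → ℝ)
    (hq : ∀ n, q n = (P n).real {ω | BerkJones.Mplus (cdf ν) (fun i => X n i ω) ≤ c}) :
    (∀ n : ℕ, 1 ≤ n →
      2 * q n - q n ^ 2 ≤ (P n).real {ω | BerkJones.M (cdf ν) (fun i => X n i ω) ≤ c} ∧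
      (P n).real {ω | BerkJones.M (cdf ν) (fun i => X n i ω) ≤ c} ≤ 2 * q n) ∧
    Tendsto
      (fun n => (P n).real {ω | BerkJones.M (cdf ν) (fun i => X n i ω) ≤ c}
        - (2 * q n - q n ^ 2))
      atTop (𝓝 0) := by
  have hmono := monotone_cdf ν
  set p : ℕ → ℝ := fun n => (P n).real {ω | BerkJones.M (cdf ν) (fun i => X n i ω) ≤ c} with hp
  have hq' : ∀ n, q n =
      (Measure.pi fun _ : Fin n => BerkJones.unif).real {x | BerkJones.Mplus id x ≤ c} := by
    intro n
    rw [hq]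
    simp only [BerkJones.Mplus_comp_monotone hmono]
    exact ((hX n).hasLaw_cdf hF).measureReal_eq (p := fun x => BerkJones.Mplus id x ≤ c)
      (BerkJones.measurableSet_Mplus_le n c)
  have hp' : ∀ n, p n =
      (Measure.pi fun _ : Fin n => BerkJones.unif).real {x | BerkJones.M id x ≤ c} := by
    intro n
    simp only [hp, BerkJones.M_comp_monotone hmono]
    refine ((hX n).hasLaw_cdf hF).measureReal_eq (p := fun x => BerkJones.M id x ≤ c) ?_
    rw [BerkJones.setOf_M_le_eq_union]
    exact (BerkJones.measurableSet_Mplus_le n c).union (BerkJones.measurableSet_Mminus_le n c)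
  have hbd : ∀ n, 2 * q n - q n ^ 2 ≤ p n ∧ p n ≤ 2 * q n := by
    intro n
    rw [hq', hp']
    exact BerkJones.measureReal_M_le_bounds n c
  refine ⟨fun n _ => hbd n, ?_⟩
  change Tendsto (fun n => p n - (2 * q n - q n ^ 2)) atTop (𝓝 0)
  rcases hc.1.eq_or_lt with rfl | hc0
  · refine tendsto_const_nhds.congr' ?_
    filter_upwards [eventually_ge_atTop 1] with n hn
    have h0 : q n = 0 := (hq' n).trans (BerkJones.measureReal_Mplus_le_zero hn)
    have h := hbd n
    rw [h0] at h ⊢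
    linarith [h.1, h.2]
  · have hq1 : Tendsto q atTop (𝓝 1) :=
      (BerkJones.tendsto_measureReal_Mplus_le hc0).congr fun n => (hq' n).symm
    have hlim : Tendsto (fun n => 1 - (2 * q n - q n ^ 2)) atTop (𝓝 0) := by
      have h := (tendsto_const_nhds (x := (1 : ℝ))).sub ((hq1.const_mul 2).sub (hq1.pow 2))
      norm_num at h
      exact h
    -- Squeeze using only `p n ≤ 1`: once `q → 1`, the lower bound already tends to `1`.
    refine tendsto_of_tendsto_of_tendsto_of_le_of_le tendsto_const_nhds hlim
      (fun n => sub_nonneg.2 (hbd n).1) fun n => sub_le_sub_right ?_ _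
    rw [hp']
    exact measureReal_le_one
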